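/- Let $H$ be a finite poset whose Hasse diagram (the graph on $H$ in which two elements are adjacent when one covers the other) is a tree, and let $k\ge 2$ be the height of $H$, i.e. the largest cardinality of a chain in $H$. A family $\mathcal F\subseteq 2^{[n]}$, where $[n]=\{1,\dots,n\}$, contains $H$ as an induced subposet if there is an injection $f:H\to\mathcal F$ such that for all $u,v\in H$, $u\le v$ if and only if $f(u)\subseteq f(v)$. Let $La^*(n,H)$ be the largest size of a family $\mathcal F\subseteq 2^{[n]}$ that does not contain $H$ as an induced subposet. Then, as $n\to\infty$, $$La^*(n,H)=(k-1)\binom{n}{\lfloor n/2\rfloor}(1+o(1)).$$ Moreover, for every $\varepsilon>0$ there is $n_0=n_0(H,\varepsilon)$ such that for all $n\ge n_0$, every family $\mathcal F\subseteq 2^{[n]}$ with $|\mathcal F|\ge (k-1+\varepsilon)\binom{n}{\lfloor n/2\rfloor}$ contains $H$ as an induced subposet. -/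

import Mathlib

open Filter Asymptotics

/-- The height of a poset: the largest cardinality of a chain in it. -/
noncomputable def posetHeight (H : Type*) [PartialOrder H] : ℕ∞ :=
  (Set.univ : Set H).chainHeight (· ≤ ·)

/-- The family `F` of subsets of an `n`-element set, ordered by inclusion, contains `H` as an
induced subposet: there is an injection `f : H → F` with `u ≤ v ↔ f u ⊆ f v`. -/
def ContainsInduced {n : ℕ} (F : Finset (Finset (Fin n))) (H : Type*) [PartialOrder H] : Prop :=
  ∃ f : H → Finset (Fin n),
    Function.Injective f ∧ (∀ u, f u ∈ F) ∧ ∀ u v, u ≤ v ↔ f u ⊆ f v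

open Classical in
/-- `La*(n, H)`: the largest size of a family of subsets of an `n`-element set that does not
contain `H` as an induced subposet. -/
noncomputable def LaStar (n : ℕ) (H : Type*) [PartialOrder H] : ℕ :=
  (Finset.univ.filter fun F : Finset (Finset (Fin n)) => ¬ ContainsInduced F H).sup Finset.card

/-! Lower bound: `k - 1` consecutive levels of the cube next to the middle contain no chain of `k`
sets, and each has size asymptotic to the middle binomial coefficient. Upper bound: label `H` by a
strictly monotone map `l` to `Fin k`, and look for levels `G 0, ..., G (k - 1)` inside the family
from which `H` can be embedded greedily, one leaf of the tree at a time, with `x` sent into `G (l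
x)`. A leaf hangs on one neighbour `p`, so what is needed is `Extendable`: from the image of `p` one
can step into any other level while avoiding all comparabilities, with the boundedly many sets
already used, that transitivity does not force.

Such levels come from an extremal choice. A maximal chain of the cube is a `Numbering`, and its
members are the prefixes. Take `G` maximizing `packingPotential`: the total number of disjoint
`k`-chains through the levels, minus `δ` times the number of incidences. If stepping from some `p`
failed, every packed chain through `p` would lie on a maximal chain carrying an unwanted
comparability. For sets of size near `n / 2` these form less than a fraction `δ` of the maximal
chains through `p`, so erasing `p` would raise the potential. The maximum is positive because an
average maximal chain meets more than `k - 1` members of the family, so no level is empty. -/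

/-- From every set in a level of `G` one can step to a strictly smaller (larger) set in any lower
(higher) level while staying incomparable to prescribed sets of `F`, at most `m` in number, except
those that are comparable by transitivity. -/
def Extendable {α : Type*} {k : ℕ} (F : Finset (Finset α)) (G : Fin k → Finset (Finset α))
    (m : ℕ) : Prop :=
  ∀ i j, ∀ p ∈ G i, ∀ S ⊆ F, S.card ≤ m →
    (j < i → ∃ v ∈ G j, v ⊂ p ∧ ∀ s ∈ S, p ⊆ s ∨ (¬ s ⊆ v ∧ ¬ v ⊆ s)) ∧
    (i < j → ∃ v ∈ G j, p ⊂ v ∧ ∀ s ∈ S, s ⊆ p ∨ (¬ s ⊆ v ∧ ¬ v ⊆ s))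

/-! ### Leaves of tree posets. -/

section Tree

variable {H : Type*} [PartialOrder H]

/-- A minimal element never lies strictly between two others, so deleting it creates no new cover.
-/
theorem hasse_induce_compl_of_isMin {v : H} (hv : IsMin v) :
    SimpleGraph.hasse ↥({v}ᶜ : Set H) = (SimpleGraph.hasse H).induce {v}ᶜ := by
  have key : ∀ a b : ↥({v}ᶜ : Set H), a ⋖ b ↔ (a : H) ⋖ b := fun a b =>
    ⟨fun h => ⟨h.1, fun c hac hcb =>
      h.2 (c := ⟨c, fun hc => by subst hc; exact hv.not_lt hac⟩) hac hcb⟩,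
      fun h => ⟨h.1, fun c hac hcb => h.2 (c := (c : H)) hac hcb⟩⟩
  ext a b
  simp [key]

theorem hasse_induce_compl_of_isMax {v : H} (hv : IsMax v) :
    SimpleGraph.hasse ↥({v}ᶜ : Set H) = (SimpleGraph.hasse H).induce {v}ᶜ := by
  have key : ∀ a b : ↥({v}ᶜ : Set H), a ⋖ b ↔ (a : H) ⋖ b := fun a b =>
    ⟨fun h => ⟨h.1, fun c hac hcb =>
      h.2 (c := ⟨c, fun hc => by subst hc; exact hv.not_lt hcb⟩) hac hcb⟩,
      fun h => ⟨h.1, fun c hac hcb => h.2 (c := (c : H)) hac hcb⟩⟩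
  ext a b
  simp [key]

/-- A nontrivial tree poset has an element whose removal leaves a tree poset and which is either
minimal with a single cover, or maximal and covering a single element. -/
theorem exists_leaf_of_hasse_isTree [Finite H] [Nontrivial H]
    (hH : (SimpleGraph.hasse H).IsTree) :
    ∃ v p : H, (SimpleGraph.hasse ↥({v}ᶜ : Set H)).IsTree ∧
      ((v < p ∧ ∀ x, x ≠ v → ((v ≤ x ↔ p ≤ x) ∧ ¬ x ≤ v)) ∨
        (p < v ∧ ∀ x, x ≠ v → ((x ≤ v ↔ x ≤ p) ∧ ¬ v ≤ x))) := by
  classical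
  have := Fintype.ofFinite H
  obtain ⟨v, hv⟩ := hH.exists_vert_degree_one_of_nontrivial
  have htree : ((SimpleGraph.hasse H).induce {v}ᶜ).IsTree :=
    ⟨hH.connected.induce_compl_singleton_of_degree_eq_one hv, hH.isAcyclic.induce _⟩
  obtain ⟨p, hp, huniq⟩ := SimpleGraph.degree_eq_one_iff_existsUnique_adj.mp hv
  -- Anything above or below `v` is reached through a cover at `v`, and the only neighbour of `v` is
  -- `p`.
  have hup : ∀ x, v < x → v ⋖ p ∧ p ≤ x := by
    intro x hx
    obtain ⟨c, hc, hcx⟩ := exists_covBy_le_of_lt hx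
    obtain rfl := huniq c (Or.inl hc)
    exact ⟨hc, hcx⟩
  have hdown : ∀ x, x < v → p ⋖ v ∧ x ≤ p := by
    intro x hx
    obtain ⟨c, hcx, hc⟩ := exists_le_covBy_of_lt hx
    obtain rfl := huniq c (Or.inr hc)
    exact ⟨hc, hcx⟩
  rcases hp with hp | hp
  · have hmin : ∀ x, ¬ x < v := fun x hx => lt_asymm hp.lt (hdown x hx).1.lt
    refine ⟨v, p, ?_, Or.inl ⟨hp.lt, fun x hx => ⟨⟨fun h => (hup x (lt_of_le_of_ne h hx.symm)).2,
      fun h => hp.le.trans h⟩, fun h => hmin x (lt_of_le_of_ne h hx)⟩⟩⟩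
    rwa [hasse_induce_compl_of_isMin]
    exact isMin_iff_forall_not_lt.mpr hmin
  · have hmax : ∀ x, ¬ v < x := fun x hx => lt_asymm hp.lt (hup x hx).1.lt
    refine ⟨v, p, ?_, Or.inr ⟨hp.lt, fun x hx => ⟨⟨fun h => (hdown x (lt_of_le_of_ne h hx)).2,
      fun h => h.trans hp.le⟩, fun h => hmax x (lt_of_le_of_ne h hx.symm)⟩⟩⟩
    rwa [hasse_induce_compl_of_isMax]
    exact isMax_iff_forall_not_lt.mpr hmax

end Tree

/-! ### Greedy embedding and the labelling by `Fin k`. -/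

/-- Induction on the size of `H`: embed `H` without a leaf `v`, then place `v` by a step from the
image of its neighbour `p`. The exceptions allowed in `Extendable` are exactly the comparabilities
that `v` inherits through `p`. -/
theorem Extendable.exists_orderEmbedding {α : Type*} {k m : ℕ} {F : Finset (Finset α)}
    {G : Fin k → Finset (Finset α)} (hG : Extendable F G m) (hGF : ∀ i, G i ⊆ F)
    (hne : ∀ i, (G i).Nonempty) (N : ℕ) :
    ∀ (H : Type*) [PartialOrder H] [Finite H], Nat.card H = N → N ≤ m →
      (SimpleGraph.hasse H).IsTree → ∀ l : H → Fin k, StrictMono l →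
      ∃ g : H → Finset α, (∀ x, g x ∈ G (l x)) ∧ ∀ x y, x ≤ y ↔ g x ⊆ g y := by
  classical
  induction N with
  | zero =>
    intro H _ _ hN _ hH
    have := hH.connected.nonempty
    exact absurd hN Nat.card_pos.ne'
  | succ N ih =>
    intro H _ _ hN hNm hH l hl
    have := Fintype.ofFinite H
    rcases subsingleton_or_nontrivial H with hs | hs
    · choose g hg using fun x => hne (l x)
      exact ⟨g, hg, fun x y => by obtain rfl := Subsingleton.elim x y; simp⟩
    obtain ⟨v, p, htree, hvp⟩ := exists_leaf_of_hasse_isTree hH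
    have hcard : Nat.card ↥({v}ᶜ : Set H) = N := by
      rw [Nat.card_eq_fintype_card] at hN ⊢
      rw [Fintype.card_compl_set, hN]
      simp
    obtain ⟨g, hg, hgle⟩ := ih ↥({v}ᶜ : Set H) hcard (by omega) htree (fun x => l x)
      (fun a b hab => hl hab)
    have hpv : p ≠ v := by rcases hvp with h | h <;> [exact h.1.ne'; exact h.1.ne]
    set S := Finset.univ.image g with hS
    have hSF : S ⊆ F := by
      intro s hs
      obtain ⟨x, -, rfl⟩ := Finset.mem_image.mp hs
      exact hGF _ (hg x)
    have hSm : S.card ≤ m := by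
      refine Finset.card_image_le.trans ?_
      rw [Finset.card_univ, ← Nat.card_eq_fintype_card, hcard]
      omega
    have hmem : ∀ x, g x ∈ S := fun x => Finset.mem_image_of_mem _ (Finset.mem_univ _)
    obtain ⟨w, hw, hcomp⟩ : ∃ w ∈ G (l v), ∀ x (hx : x ≠ v),
        (v ≤ x ↔ w ⊆ g ⟨x, hx⟩) ∧ (x ≤ v ↔ g ⟨x, hx⟩ ⊆ w) := by
      rcases hvp with ⟨hlt, h⟩ | ⟨hlt, h⟩
      · obtain ⟨w, hw, hwp, hwS⟩ := (hG _ (l v) _ (hg ⟨p, hpv⟩) S hSF hSm).1 (hl hlt)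
        refine ⟨w, hw, fun x hx => ?_⟩
        have h1 : p ≤ x ↔ _ := hgle ⟨p, hpv⟩ ⟨x, hx⟩
        rw [(h x hx).1, h1]
        simp only [(h x hx).2, false_iff]
        rcases hwS _ (hmem ⟨x, hx⟩) with h2 | h2
        · exact ⟨⟨fun _ => hwp.subset.trans h2, fun _ => h2⟩,
            fun h3 => hwp.not_subset (h2.trans h3)⟩
        · exact ⟨⟨fun h3 => hwp.subset.trans h3, fun h3 => absurd h3 h2.2⟩, h2.1⟩
      · obtain ⟨w, hw, hwp, hwS⟩ := (hG _ (l v) _ (hg ⟨p, hpv⟩) S hSF hSm).2 (hl hlt)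
        refine ⟨w, hw, fun x hx => ?_⟩
        have h1 : x ≤ p ↔ _ := hgle ⟨x, hx⟩ ⟨p, hpv⟩
        rw [(h x hx).1, h1]
        simp only [(h x hx).2, false_iff]
        rcases hwS _ (hmem ⟨x, hx⟩) with h2 | h2
        · exact ⟨fun h3 => hwp.not_subset (h3.trans h2),
            ⟨fun _ => h2.trans hwp.subset, fun _ => h2⟩⟩
        · exact ⟨h2.2, ⟨fun h3 => h3.trans hwp.subset, fun h3 => absurd h3 h2.1⟩⟩
    refine ⟨fun x => if hx : x = v then w else g ⟨x, hx⟩, fun x => ?_, fun x y => ?_⟩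
    · by_cases hx : x = v
      · subst hx; simpa using hw
      · simpa [hx] using hg ⟨x, hx⟩
    · by_cases hx : x = v <;> by_cases hy : y = v
      · simp [hx, hy]
      · subst hx; simpa [hy] using (hcomp y hy).1
      · subst hy; simpa [hx] using (hcomp x hx).2
      · simp only [hx, hy, dite_false]
        exact hgle ⟨x, hx⟩ ⟨y, hy⟩

/-- A finite poset of height `k` has a strictly monotone map to `Fin k`. -/
theorem exists_strictMono_fin {H : Type*} [PartialOrder H] [Finite H] {k : ℕ}
    (hheight : posetHeight H = (k : ℕ∞)) : ∃ l : H → Fin k, StrictMono l := by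
  classical
  have hlt : ∀ x : H, Order.height x < (k : ℕ∞) := by
    intro x
    by_contra! h
    -- A series of length `k` has `k + 1` elements, one too many for the height.
    obtain ⟨s, -, hs⟩ := Order.exists_series_of_le_height x h
    have hc : IsChain (· ≤ ·) (Set.range s) := by
      rintro _ ⟨a, rfl⟩ _ ⟨b, rfl⟩ -
      rcases le_total a b with h | h
      · exact Or.inl (s.strictMono.monotone h)
      · exact Or.inr (s.strictMono.monotone h)
    have h1 := Set.encard_le_chainHeight_of_isChain (r := (· ≤ ·)) Set.univ _
      (Set.subset_univ _) hc
    rw [← Set.image_univ, s.strictMono.injective.encard_image, Set.encard_univ] at h1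
    change _ ≤ posetHeight H at h1
    rw [hheight] at h1
    simp [hs] at h1
    norm_cast at h1
    omega
  refine ⟨fun x => ⟨(Order.height x).toNat, ?_⟩, fun x y hxy => ?_⟩
  · rw [← ENat.natCast_lt_natCast, ENat.natCast_toNat (hlt x).ne_top]
    exact hlt x
  · rw [Fin.mk_lt_mk, ← ENat.natCast_lt_natCast, ENat.natCast_toNat (hlt x).ne_top,
      ENat.natCast_toNat (hlt y).ne_top]
    exact Order.height_strictMono hxy ((hlt x).trans_le le_top)

/-! ### Counting maximal chains through a fixed set. -/

namespace Numbering

variable {X : Type*} [Fintype X] [DecidableEq X]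

/-- Swapping two positions on the same side of the cut at `s.card` permutes `prefixed s`. Hence,
among these numberings, `x` is equidistributed over the positions open to it. -/
theorem card_prefixed_filter_apply_eq_congr (s : Finset X) (x : X) {a b : Fin (Fintype.card X)}
    (hab : (a : ℕ) < s.card ↔ (b : ℕ) < s.card) :
    ((prefixed s).filter fun f => f x = a).card = ((prefixed s).filter fun f => f x = b).card := by
  have key : ∀ f : Numbering X, IsPrefix (f.trans (Equiv.swap a b)) s ↔ IsPrefix f s := by
    intro f
    refine forall_congr' fun y => ?_
    have : ((Equiv.swap a b (f y) : Fin _) : ℕ) < s.card ↔ (f y : ℕ) < s.card := by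
      rcases eq_or_ne (f y) a with h | h
      · rw [h, Equiv.swap_apply_left, hab]
      rcases eq_or_ne (f y) b with h' | h'
      · rw [h', Equiv.swap_apply_right, hab]
      · rw [Equiv.swap_apply_of_ne_of_ne h h']
    rw [Equiv.trans_apply, this]
  refine Finset.card_bij' (fun f _ => f.trans (Equiv.swap a b))
    (fun f _ => f.trans (Equiv.swap a b)) ?_ ?_ ?_ ?_
  · intro f hf
    simp only [Finset.mem_filter, mem_prefixed] at hf ⊢
    exact ⟨(key f).2 hf.1, by simp [hf.2]⟩
  · intro f hf
    simp only [Finset.mem_filter, mem_prefixed] at hf ⊢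
    exact ⟨(key f).2 hf.1, by simp [hf.2]⟩
  · intro f _
    ext; simp
  · intro f _
    ext; simp

theorem card_mul_card_prefixed_filter_apply_eq {s : Finset X} {x : X}
    (B : Finset (Fin (Fintype.card X)))
    (hB : ∀ f ∈ prefixed s, f x ∈ B) (hBs : ∀ a ∈ B, ∀ b ∈ B, (a : ℕ) < s.card ↔ (b : ℕ) < s.card)
    {b : Fin (Fintype.card X)} (hb : b ∈ B) :
    B.card * ((prefixed s).filter fun f => f x = b).card = (prefixed s).card := by
  rw [Finset.card_eq_sum_card_fiberwise (f := fun f : Numbering X => f x) (t := B) hB,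
    Finset.sum_congr rfl fun a ha => card_prefixed_filter_apply_eq_congr s x (hBs a ha b hb)]
  simp

theorem card_mul_card_prefixed_filter_apply_eq_of_mem {s : Finset X} {x : X} (hx : x ∈ s)
    {b : Fin (Fintype.card X)} (hb : (b : ℕ) < s.card) :
    s.card * ((prefixed s).filter fun f => f x = b).card = (prefixed s).card := by
  have hcard : (Finset.univ.filter fun a : Fin (Fintype.card X) => (a : ℕ) < s.card).card
      = s.card := by
    rw [Fin.card_filter_val_lt, min_eq_right s.card_le_univ]
  rw [← card_mul_card_prefixed_filter_apply_eq
    (Finset.univ.filter fun a : Fin (Fintype.card X) => (a : ℕ) < s.card) _ _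
    (Finset.mem_filter.2 ⟨Finset.mem_univ _, hb⟩), hcard]
  · intro f hf
    simpa using (mem_prefixed.1 hf x).1 hx
  · intro a ha b hb
    simp_all

theorem card_mul_card_prefixed_filter_apply_eq_of_notMem {s : Finset X} {x : X} (hx : x ∉ s)
    {b : Fin (Fintype.card X)} (hb : s.card ≤ (b : ℕ)) :
    (Fintype.card X - s.card) * ((prefixed s).filter fun f => f x = b).card
      = (prefixed s).card := by
  have hcard : (Finset.univ.filter fun a : Fin (Fintype.card X) => ¬ (a : ℕ) < s.card).card
      = Fintype.card X - s.card := by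
    have := Finset.card_filter_add_card_filter_not (s := Finset.univ)
      (fun a : Fin (Fintype.card X) => (a : ℕ) < s.card)
    rw [Fin.card_filter_val_lt, min_eq_right s.card_le_univ, Finset.card_univ,
      Fintype.card_fin] at this
    omega
  rw [← card_mul_card_prefixed_filter_apply_eq
    (Finset.univ.filter fun a : Fin (Fintype.card X) => ¬ (a : ℕ) < s.card) _ _
    (Finset.mem_filter.2 ⟨Finset.mem_univ _, hb.not_gt⟩), hcard]
  · intro f hf
    simpa using (mem_prefixed.1 hf x).not.1 hx
  · intro a ha b hb
    simp_all
    omega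

/-- Union bound over events, each of probability at most `1 / c`. -/
theorem card_prefixed_filter_exists_mul_le {s : Finset X} {c : ℕ}
    (T : Finset (X × Fin (Fintype.card X)))
    (hT : ∀ t ∈ T, c * ((prefixed s).filter fun f => f t.1 = t.2).card ≤ (prefixed s).card) :
    c * ((prefixed s).filter fun f => ∃ t ∈ T, f t.1 = t.2).card ≤ T.card * (prefixed s).card := by
  have hsub : ((prefixed s).filter fun f => ∃ t ∈ T, f t.1 = t.2)
      ⊆ T.biUnion fun t => (prefixed s).filter fun f => f t.1 = t.2 := by
    intro f hf
    obtain ⟨hf, t, ht, h⟩ := Finset.mem_filter.1 hf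
    exact Finset.mem_biUnion.2 ⟨t, ht, Finset.mem_filter.2 ⟨hf, h⟩⟩
  calc _ ≤ c * ∑ t ∈ T, ((prefixed s).filter fun f => f t.1 = t.2).card :=
        Nat.mul_le_mul_left _ ((Finset.card_le_card hsub).trans Finset.card_biUnion_le)
    _ ≤ _ := by
        rw [Finset.mul_sum, ← smul_eq_mul, ← Finset.sum_const]
        exact Finset.sum_le_sum hT

theorem card_Ico_fin_le (a b : ℕ) {N : ℕ} :
    (Finset.univ.filter fun i : Fin N => a ≤ (i : ℕ) ∧ (i : ℕ) < b).card ≤ b - a := by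
  rw [← Nat.card_Ico a b, ← Finset.card_map Fin.valEmbedding]
  refine Finset.card_le_card fun i hi => ?_
  obtain ⟨j, hj, rfl⟩ := Finset.mem_map.1 hi
  simpa using hj

/-- Few maximal chains through `p` contain a set of size at least `lo` strictly below `p` that is
comparable to a given `s` not containing `p`. -/
theorem card_prefixed_filter_comparable_below_le {p s : Finset X} {lo hi : ℕ} (hps : ¬ p ⊆ s)
    (hlop : lo ≤ p.card) (hphi : p.card ≤ hi) (hlos : lo ≤ s.card) :
    lo * ((prefixed p).filter fun f =>
        ∃ v, IsPrefix f v ∧ v ⊂ p ∧ lo ≤ v.card ∧ (s ⊆ v ∨ v ⊆ s)).card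
      ≤ 2 * (hi - lo) * (prefixed p).card := by
  obtain ⟨x, hxp, hxs⟩ := Finset.not_subset.1 hps
  have hp0 : 0 < p.card := Finset.card_pos.2 ⟨x, hxp⟩
  have hpN : p.card - 1 < Fintype.card X := by have := p.card_le_univ; omega
  -- `T` lists the events "this element has this position" that a comparability forces. If `v ⊆ s`,
  -- then `v` misses `x`, so `x` has a position in `[lo, p.card)`. If `s ⊆ v ⊂ p`, the last element
  -- of `p` is outside `v`, hence in `p \ s`. There are at most `hi - lo` events of each kind, each
  -- of probability `1 / p.card`.
  let T : Finset (X × Fin (Fintype.card X)) :=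
    ({x} : Finset X) ×ˢ (Finset.univ.filter fun i : Fin (Fintype.card X) =>
      lo ≤ (i : ℕ) ∧ (i : ℕ) < p.card) ∪
    if s ⊆ p then (p \ s) ×ˢ {⟨p.card - 1, hpN⟩} else ∅
  have hTcard : T.card ≤ 2 * (hi - lo) := by
    refine (Finset.card_union_le _ _).trans ?_
    have h1 := card_Ico_fin_le lo p.card (N := Fintype.card X)
    rw [Finset.card_product, Finset.card_singleton]
    split_ifs with h
    · rw [Finset.card_product, Finset.card_singleton, Finset.card_sdiff_of_subset h]
      omega
    · rw [Finset.card_empty]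
      omega
  have hT : ∀ t ∈ T, t.1 ∈ p ∧ (t.2 : ℕ) < p.card := by
    rintro ⟨y, b⟩ ht
    rcases Finset.mem_union.1 ht with ht | ht
    · simp only [Finset.mem_product, Finset.mem_singleton, Finset.mem_filter] at ht
      exact ⟨ht.1 ▸ hxp, ht.2.2.2⟩
    · split_ifs at ht
      · simp only [Finset.mem_product, Finset.mem_singleton, Finset.mem_sdiff] at ht
        refine ⟨ht.1.1, ?_⟩
        simp only [ht.2]
        omega
      · simp at ht
  have hmain := card_prefixed_filter_exists_mul_le (s := p) (c := p.card) T fun t ht =>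
    (card_mul_card_prefixed_filter_apply_eq_of_mem (hT t ht).1 (hT t ht).2).le
  refine le_trans (Nat.mul_le_mul hlop (Finset.card_le_card ?_))
    (hmain.trans (Nat.mul_le_mul_right _ hTcard))
  intro f hf
  obtain ⟨hfp, v, hfv, hvp, hlov, hcomp⟩ := Finset.mem_filter.1 hf
  refine Finset.mem_filter.2 ⟨hfp, ?_⟩
  rw [mem_prefixed] at hfp
  rcases hcomp with hsv | hvs
  · have hvc := Finset.card_lt_card hvp
    have hy : ((f (f.symm ⟨p.card - 1, hpN⟩) : Fin _) : ℕ) = p.card - 1 := by simp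
    refine ⟨(f.symm ⟨p.card - 1, hpN⟩, ⟨p.card - 1, hpN⟩), ?_, by simp⟩
    refine Finset.mem_union_right _ ?_
    rw [if_pos (hsv.trans hvp.subset), Finset.mem_product, Finset.mem_sdiff]
    refine ⟨⟨?_, fun h => ?_⟩, Finset.mem_singleton_self _⟩
    · rw [hfp, hy]; omega
    · have := (hfv _).1 (hsv h)
      rw [hy] at this; omega
  · refine ⟨(x, f x), Finset.mem_union_left _ ?_, rfl⟩
    have h1 := (hfp x).1 hxp
    have h2 := (hfv x).not.1 fun h => hxs (hvs h)
    simp only [Finset.mem_product, Finset.mem_singleton, Finset.mem_filter, Finset.mem_univ]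
    exact ⟨trivial, trivial, by omega, h1⟩

/-- Few maximal chains through `p` contain a set of size at most `hi` strictly above `p` that is
comparable to a given `s` not contained in `p`. -/
theorem card_prefixed_filter_comparable_above_le {p s : Finset X} {lo hi : ℕ} (hsp : ¬ s ⊆ p)
    (hlop : lo ≤ p.card) (hphi : p.card ≤ hi) (hshi : s.card ≤ hi)
    (hlohi : lo + hi ≤ Fintype.card X) :
    lo * ((prefixed p).filter fun f =>
        ∃ v, IsPrefix f v ∧ p ⊂ v ∧ v.card ≤ hi ∧ (s ⊆ v ∨ v ⊆ s)).card
      ≤ 2 * (hi - lo) * (prefixed p).card := by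
  obtain ⟨x, hxs, hxp⟩ := Finset.not_subset.1 hsp
  have hpN : p.card < Fintype.card X :=
    Finset.card_lt_univ_of_notMem hxp
  -- Dually, `s ⊆ v` forces `x` into a position in `[p.card, hi)`, and `v ⊆ s` forces the first
  -- element after `p` into `s \ p`. Each event has probability `1 / (Fintype.card X - p.card)`,
  -- which is at most `1 / lo` by `hlohi`.
  let T : Finset (X × Fin (Fintype.card X)) :=
    ({x} : Finset X) ×ˢ (Finset.univ.filter fun i : Fin (Fintype.card X) =>
      p.card ≤ (i : ℕ) ∧ (i : ℕ) < hi) ∪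
    if p ⊆ s then (s \ p) ×ˢ {⟨p.card, hpN⟩} else ∅
  have hTcard : T.card ≤ 2 * (hi - lo) := by
    refine (Finset.card_union_le _ _).trans ?_
    have h1 := card_Ico_fin_le p.card hi (N := Fintype.card X)
    rw [Finset.card_product, Finset.card_singleton]
    split_ifs with h
    · rw [Finset.card_product, Finset.card_singleton, Finset.card_sdiff_of_subset h]
      omega
    · rw [Finset.card_empty]
      omega
  have hT : ∀ t ∈ T, t.1 ∉ p ∧ p.card ≤ (t.2 : ℕ) := by
    rintro ⟨y, b⟩ ht
    rcases Finset.mem_union.1 ht with ht | ht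
    · simp only [Finset.mem_product, Finset.mem_singleton, Finset.mem_filter] at ht
      exact ⟨ht.1 ▸ hxp, ht.2.2.1⟩
    · split_ifs at ht
      · simp only [Finset.mem_product, Finset.mem_singleton, Finset.mem_sdiff] at ht
        exact ⟨ht.1.2, by simp only [ht.2, le_refl]⟩
      · simp at ht
  have hmain := card_prefixed_filter_exists_mul_le (s := p) (c := Fintype.card X - p.card) T
    fun t ht => (card_mul_card_prefixed_filter_apply_eq_of_notMem (hT t ht).1 (hT t ht).2).le
  refine le_trans (Nat.mul_le_mul (by omega) (Finset.card_le_card ?_))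
    (hmain.trans (Nat.mul_le_mul_right _ hTcard))
  intro f hf
  obtain ⟨hfp, v, hfv, hpv, hvhi, hcomp⟩ := Finset.mem_filter.1 hf
  refine Finset.mem_filter.2 ⟨hfp, ?_⟩
  rw [mem_prefixed] at hfp
  rcases hcomp with hsv | hvs
  · refine ⟨(x, f x), Finset.mem_union_left _ ?_, rfl⟩
    have h1 := (hfp x).not.1 hxp
    have h2 := (hfv x).1 (hsv hxs)
    simp only [Finset.mem_product, Finset.mem_singleton, Finset.mem_filter, Finset.mem_univ]
    exact ⟨trivial, trivial, by omega, by omega⟩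
  · have hvc := Finset.card_lt_card hpv
    have hy : ((f (f.symm ⟨p.card, hpN⟩) : Fin _) : ℕ) = p.card := by simp
    refine ⟨(f.symm ⟨p.card, hpN⟩, ⟨p.card, hpN⟩), ?_, by simp⟩
    refine Finset.mem_union_right _ ?_
    rw [if_pos (hpv.subset.trans hvs), Finset.mem_product, Finset.mem_sdiff]
    refine ⟨⟨hvs ?_, fun h => ?_⟩, Finset.mem_singleton_self _⟩
    · rw [hfv, hy]; omega
    · have := (hfp _).1 h
      rw [hy] at this; omega

end Numbering

/-! ### Packings of chains and the maximizer of the potential. -/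

namespace Numbering

variable {X : Type*} [Fintype X] {k : ℕ}

/-- A set of chains `c 0 ⊂ c 1 ⊂ ⋯` of prefixes of `f` with `c i ∈ G i`, any two of which differ in
every coordinate. -/
def IsPacking (f : Numbering X) (G : Fin k → Finset (Finset X))
    (P : Finset (Fin k → Finset X)) : Prop :=
  (∀ c ∈ P, StrictMono c ∧ ∀ i, c i ∈ G i ∧ IsPrefix f (c i)) ∧
    ∀ c ∈ P, ∀ d ∈ P, ∀ i, c i = d i → c = d

open Classical in
/-- The largest size of a packing of chains of prefixes of `f` through the levels `G`. -/
noncomputable def packingNumber (f : Numbering X) (G : Fin k → Finset (Finset X)) : ℕ :=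
  (Finset.univ.filter fun P => IsPacking f G P).sup Finset.card

theorem IsPacking.card_le_packingNumber {f : Numbering X} {G : Fin k → Finset (Finset X)}
    {P : Finset (Fin k → Finset X)} (hP : IsPacking f G P) : P.card ≤ packingNumber f G := by
  classical
  exact Finset.le_sup (f := Finset.card) (Finset.mem_filter.2 ⟨Finset.mem_univ _, hP⟩)

theorem exists_isPacking_card_eq (f : Numbering X) (G : Fin k → Finset (Finset X)) :
    ∃ P, IsPacking f G P ∧ P.card = packingNumber f G := by
  classical
  obtain ⟨P, hP, h⟩ := Finset.exists_mem_eq_sup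
    (Finset.univ.filter fun P : Finset (Fin k → Finset X) => IsPacking f G P)
    ⟨∅, Finset.mem_filter.2 ⟨Finset.mem_univ _, by simp [IsPacking]⟩⟩ Finset.card
  exact ⟨P, (Finset.mem_filter.1 hP).2, h.symm⟩

theorem nonempty_of_packingNumber_pos {f : Numbering X} {G : Fin k → Finset (Finset X)}
    (h : 0 < packingNumber f G) (i : Fin k) : (G i).Nonempty := by
  obtain ⟨P, hP, hcard⟩ := exists_isPacking_card_eq f G
  obtain ⟨c, hc⟩ := Finset.card_pos.1 (hcard ▸ h)
  exact ⟨c i, ((hP.1 c hc).2 i).1⟩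

theorem IsPrefix.eq_of_card_eq {f : Numbering X} {s t : Finset X} (hs : IsPrefix f s)
    (ht : IsPrefix f t) (h : s.card = t.card) : s = t :=
  (hs.subset_of_card_le_card ht h.le).antisymm (ht.subset_of_card_le_card hs h.ge)

variable [DecidableEq X]

/-- Sliding a window of length `k` along the members of `F` that are prefixes of `f` gives a
packing. -/
theorem card_filter_isPrefix_le_packingNumber_add (f : Numbering X) (F : Finset (Finset X))
    (hk : 1 ≤ k) :
    (F.filter fun A => IsPrefix f A).card ≤ packingNumber f (fun _ : Fin k => F) + (k - 1) := by
  classical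
  set Y := F.filter fun A => IsPrefix f A with hY
  set C := Y.image Finset.card with hC
  have hinj : Set.InjOn Finset.card (Y : Set (Finset X)) := by
    intro s hs t ht h
    exact (Finset.mem_filter.1 hs).2.eq_of_card_eq (Finset.mem_filter.1 ht).2 h
  have hCcard : C.card = Y.card := Finset.card_image_of_injOn hinj
  let e := C.orderEmbOfFin hCcard
  have he : ∀ a, ∃ A ∈ Y, A.card = e a := fun a =>
    Finset.mem_image.1 (C.orderEmbOfFin_mem hCcard a)
  choose A hAY hA using he
  have hAlt : StrictMono A := by
    intro a b hab
    have hlt : (A a).card < (A b).card := by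
      rw [hA, hA]
      exact e.strictMono hab
    refine Finset.ssubset_iff_subset_ne.2 ⟨(Finset.mem_filter.1 (hAY a)).2.subset_of_card_le_card
      (Finset.mem_filter.1 (hAY b)).2 hlt.le, fun h => ?_⟩
    rw [h] at hlt
    exact lt_irrefl _ hlt
  -- The subtraction truncates: with fewer than `k` members there is no window, and the bound holds
  -- trivially.
  let c : Fin (Y.card - (k - 1)) → Fin k → Finset X := fun a i => A ⟨a + i, by omega⟩
  have hc : ∀ a b i, c a i = c b i → a = b := by
    intro a b i h
    have := congrArg Fin.val (hAlt.injective h)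
    ext
    simpa using this
  have hP : IsPacking f (fun _ : Fin k => F) (Finset.univ.image c) := by
    constructor
    · intro d hd
      obtain ⟨a, -, rfl⟩ := Finset.mem_image.1 hd
      refine ⟨fun i j hij => hAlt ?_, fun i => Finset.mem_filter.1 (hAY _)⟩
      rw [Fin.mk_lt_mk]
      have : (i : ℕ) < j := hij
      omega
    · intro d hd d' hd' i h
      obtain ⟨a, -, rfl⟩ := Finset.mem_image.1 hd
      obtain ⟨b, -, rfl⟩ := Finset.mem_image.1 hd'
      rw [hc a b i h]
  have hcinj : Function.Injective c := fun a b h => hc a b ⟨0, hk⟩ (congrFun h _)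
  have := hP.card_le_packingNumber
  rw [Finset.card_image_of_injective _ hcinj, Finset.card_univ, Fintype.card_fin] at this
  omega

/-- Erasing a set `p` from level `i` destroys at most one chain of a packing, and none unless some
chain of prefixes passes through `p` at level `i`. -/
theorem packingNumber_le_update_erase_add (f : Numbering X) (G : Fin k → Finset (Finset X))
    (i : Fin k) (p : Finset X) (B : Finset (Numbering X))
    (hB : ∀ c : Fin k → Finset X, StrictMono c → (∀ j, c j ∈ G j ∧ IsPrefix f (c j)) → c i = p →
      f ∈ B) :
    packingNumber f G ≤
      packingNumber f (Function.update G i ((G i).erase p)) + if f ∈ B then 1 else 0 := by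
  classical
  obtain ⟨P, hP, hcard⟩ := exists_isPacking_card_eq f G
  have hP' : IsPacking f (Function.update G i ((G i).erase p)) (P.filter fun c => ¬ c i = p) := by
    refine ⟨fun c hc => ?_, fun c hc d hd => hP.2 c (Finset.filter_subset _ _ hc) d
      (Finset.filter_subset _ _ hd)⟩
    obtain ⟨hcP, hcp⟩ := Finset.mem_filter.1 hc
    refine ⟨(hP.1 c hcP).1, fun j => ⟨?_, ((hP.1 c hcP).2 j).2⟩⟩
    rcases eq_or_ne j i with rfl | hj
    · rw [Function.update_self]
      exact Finset.mem_erase.2 ⟨hcp, ((hP.1 c hcP).2 _).1⟩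
    · rw [Function.update_of_ne hj]
      exact ((hP.1 c hcP).2 _).1
  have hle := hP'.card_le_packingNumber
  have hsplit := Finset.card_filter_add_card_filter_not (s := P) (fun c => c i = p)
  suffices (P.filter fun c => c i = p).card ≤ if f ∈ B then 1 else 0 by omega
  split_ifs with hf
  · refine Finset.card_le_one.2 fun c hc d hd => ?_
    rw [Finset.mem_filter] at hc hd
    exact hP.2 c hc.1 d hd.1 i (hc.2.trans hd.2.symm)
  · rw [Nat.le_zero, Finset.card_eq_zero, Finset.filter_eq_empty_iff]
    intro c hc hcp
    exact hf (hB c (hP.1 c hc).1 (hP.1 c hc).2 hcp)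

/-- The total packing number of the levels `G` over all numberings, with a penalty for the number
of incidences between the levels and the numberings. -/
noncomputable def packingPotential (δ : ℝ) (G : Fin k → Finset (Finset X)) : ℝ :=
  ∑ f : Numbering X, (packingNumber f G : ℝ) - δ * ∑ i, ∑ A ∈ G i, ((prefixed A).card : ℝ)

theorem sum_update_erase {α : Type*} [DecidableEq α] (w : α → ℝ) (G : Fin k → Finset α)
    {i : Fin k} {p : α} (hp : p ∈ G i) :
    ∑ j, ∑ A ∈ Function.update G i ((G i).erase p) j, w A + w p = ∑ j, ∑ A ∈ G j, w A := by
  rw [← Finset.add_sum_erase _ _ (Finset.mem_univ i),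
    ← Finset.add_sum_erase (a := i) Finset.univ (fun j => ∑ A ∈ G j, w A) (Finset.mem_univ i),
    Function.update_self, ← Finset.add_sum_erase _ _ hp]
  have : ∑ j ∈ Finset.univ.erase i, ∑ A ∈ Function.update G i ((G i).erase p) j, w A
      = ∑ j ∈ Finset.univ.erase i, ∑ A ∈ G j, w A :=
    Finset.sum_congr rfl fun j hj => by rw [Function.update_of_ne (Finset.ne_of_mem_erase hj)]
  rw [this]
  ring

/-- Erasing `p` costs at most one packed chain for each numbering in `B` and saves the penalty `δ *
(prefixed p).card`. At a maximum the saving cannot exceed the cost. -/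
theorem mul_card_prefixed_le_of_packingPotential_le {δ : ℝ} {G : Fin k → Finset (Finset X)}
    {i : Fin k} {p : Finset X} (hp : p ∈ G i)
    (hmax : packingPotential δ (Function.update G i ((G i).erase p)) ≤ packingPotential δ G)
    (B : Finset (Numbering X))
    (hB : ∀ f, ∀ c : Fin k → Finset X, StrictMono c → (∀ j, c j ∈ G j ∧ IsPrefix f (c j)) →
      c i = p → f ∈ B) :
    δ * (prefixed p).card ≤ B.card := by
  have h1 : ∑ f : Numbering X, (packingNumber f G : ℝ) ≤
      ∑ f : Numbering X, (packingNumber f (Function.update G i ((G i).erase p)) : ℝ)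
        + B.card := by
    have : (B.card : ℝ) = ∑ f : Numbering X, ((if f ∈ B then 1 else 0 : ℕ) : ℝ) := by
      simp
    rw [this, ← Finset.sum_add_distrib]
    refine Finset.sum_le_sum fun f _ => ?_
    exact_mod_cast packingNumber_le_update_erase_add f G i p B (hB f)
  have h2 := sum_update_erase (fun A => ((prefixed A).card : ℝ)) G hp
  unfold packingPotential at hmax
  rw [← h2] at hmax
  linarith

theorem card_prefixed_pos (s : Finset X) : 0 < (prefixed s).card := by
  rw [card_prefixed]
  positivity

/-- Levels that maximize the packing potential are extendable. -/
theorem extendable_of_forall_packingPotential_le {δ : ℝ} {F : Finset (Finset X)}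
    {G : Fin k → Finset (Finset X)} {lo hi m : ℕ} (hGF : ∀ i, G i ⊆ F)
    (hmax : ∀ G' : Fin k → Finset (Finset X), (∀ i, G' i ⊆ F) →
      packingPotential δ G' ≤ packingPotential δ G)
    (hlo : ∀ A ∈ F, lo ≤ A.card) (hhi : ∀ A ∈ F, A.card ≤ hi)
    (hlohi : lo + hi ≤ Fintype.card X) (hδ : (m * (2 * (hi - lo) : ℕ) : ℝ) < δ * lo) :
    Extendable F G m := by
  classical
  have hmax' : ∀ i p, packingPotential δ (Function.update G i ((G i).erase p)) ≤
      packingPotential δ G := by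
    refine fun i p => hmax _ fun j => ?_
    rcases eq_or_ne j i with rfl | hj
    · rw [Function.update_self]
      exact (Finset.erase_subset _ _).trans (hGF _)
    · rw [Function.update_of_ne hj]
      exact hGF j
  -- Each `E s` is at most a fraction `2 * (hi - lo) / lo` of the numberings through `p`, so by `hδ`
  -- the union is less than a fraction `δ` and cannot catch all chains through `p`.
  have hcontra : ∀ i, ∀ p ∈ G i, ∀ S : Finset (Finset X), S.card ≤ m →
      ∀ E : Finset X → Finset (Numbering X),
      (∀ s ∈ S, lo * (E s).card ≤ 2 * (hi - lo) * (prefixed p).card) →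
      ¬ ∀ f, ∀ c : Fin k → Finset X, StrictMono c → (∀ j, c j ∈ G j ∧ IsPrefix f (c j)) →
        c i = p → f ∈ S.biUnion E := by
    intro i p hp S hS E hE hB
    have h1 := mul_card_prefixed_le_of_packingPotential_le hp (hmax' i p) _ hB
    have h2 : lo * (S.biUnion E).card ≤ m * (2 * (hi - lo) * (prefixed p).card) :=
      calc lo * (S.biUnion E).card ≤ lo * ∑ s ∈ S, (E s).card :=
            Nat.mul_le_mul_left _ Finset.card_biUnion_le
        _ ≤ S.card * (2 * (hi - lo) * (prefixed p).card) := by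
            rw [Finset.mul_sum, ← smul_eq_mul (a := S.card), ← Finset.sum_const]
            exact Finset.sum_le_sum hE
        _ ≤ _ := Nat.mul_le_mul_right _ hS
    have h3 : (lo : ℝ) * (S.biUnion E).card
        ≤ m * ((2 * (hi - lo) : ℕ) * (prefixed p).card) := by exact_mod_cast h2
    have hw : (0 : ℝ) < (prefixed p).card := by exact_mod_cast card_prefixed_pos p
    have h4 := mul_lt_mul_of_pos_right hδ hw
    have h5 := mul_le_mul_of_nonneg_left h1 (Nat.cast_nonneg (α := ℝ) lo)
    linarith
  intro i j p hp S hSF hSm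
  have hpF := hGF i hp
  constructor
  · intro hji
    by_contra! hv
    -- `E s` collects the numberings on which `s` obstructs the step. It is empty when `p ⊆ s`,
    -- since that comparability is allowed.
    refine hcontra i p hp S hSm (fun s => if p ⊆ s then ∅ else (prefixed p).filter fun f =>
        ∃ v, IsPrefix f v ∧ v ⊂ p ∧ lo ≤ v.card ∧ (s ⊆ v ∨ v ⊆ s)) ?_ ?_
    · intro s hs
      split_ifs with hps
      · simp
      · exact card_prefixed_filter_comparable_below_le hps (hlo p hpF) (hhi p hpF)
          (hlo s (hSF hs))
    · intro f c hc hcG hcp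
      have hlt : c j ⊂ p := hcp ▸ hc hji
      obtain ⟨s, hs, hps, hsv⟩ := hv (c j) (hcG j).1 hlt
      refine Finset.mem_biUnion.2 ⟨s, hs, ?_⟩
      rw [if_neg hps, Finset.mem_filter, mem_prefixed]
      exact ⟨hcp ▸ (hcG i).2, c j, (hcG j).2, hlt, hlo _ (hGF j (hcG j).1), by tauto⟩
  · intro hij
    by_contra! hv
    refine hcontra i p hp S hSm (fun s => if s ⊆ p then ∅ else (prefixed p).filter fun f =>
        ∃ v, IsPrefix f v ∧ p ⊂ v ∧ v.card ≤ hi ∧ (s ⊆ v ∨ v ⊆ s)) ?_ ?_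
    · intro s hs
      split_ifs with hps
      · simp
      · exact card_prefixed_filter_comparable_above_le hps (hlo p hpF) (hhi p hpF)
          (hhi s (hSF hs)) hlohi
    · intro f c hc hcG hcp
      have hlt : p ⊂ c j := hcp ▸ hc hij
      obtain ⟨s, hs, hps, hsv⟩ := hv (c j) (hcG j).1 hlt
      refine Finset.mem_biUnion.2 ⟨s, hs, ?_⟩
      rw [if_neg hps, Finset.mem_filter, mem_prefixed]
      exact ⟨hcp ▸ (hcG i).2, c j, (hcG j).2, hlt, hhi _ (hGF j (hcG j).1), by tauto⟩

/-- A numbering meeting `r` members of `F` carries at least `r - (k - 1)` packed chains, so `hF`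
makes the potential of the constant levels `F` positive. The maximizer then packs at least one
chain, which meets every level. -/
theorem exists_extendable {δ : ℝ} (hδ0 : 0 ≤ δ) {F : Finset (Finset X)} {lo hi m : ℕ} (hk : 1 ≤ k)
    (hlo : ∀ A ∈ F, lo ≤ A.card) (hhi : ∀ A ∈ F, A.card ≤ hi)
    (hlohi : lo + hi ≤ Fintype.card X) (hδ : (m * (2 * (hi - lo) : ℕ) : ℝ) < δ * lo)
    (hF : ((k : ℝ) - 1) * (Fintype.card X).factorial
      < (1 - δ * k) * ∑ A ∈ F, ((prefixed A).card : ℝ)) :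
    ∃ G : Fin k → Finset (Finset X), Extendable F G m ∧ (∀ i, G i ⊆ F) ∧
      ∀ i, (G i).Nonempty := by
  classical
  obtain ⟨G, hG, hmax⟩ := Finset.exists_max_image
    (Finset.univ.filter fun G : Fin k → Finset (Finset X) => ∀ i, G i ⊆ F) (packingPotential δ)
    ⟨fun _ => F, by simp⟩
  simp only [Finset.mem_filter, Finset.mem_univ, true_and] at hG hmax
  refine ⟨G, extendable_of_forall_packingPotential_le hG hmax hlo hhi hlohi hδ, hG, ?_⟩
  have hcount : ∑ A ∈ F, ((prefixed A).card : ℝ)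
      = ∑ f : Numbering X, ((F.filter fun A => IsPrefix f A).card : ℝ) := by
    have := Finset.sum_card_bipartiteAbove_eq_sum_card_bipartiteBelow (s := F)
      (t := (Finset.univ : Finset (Numbering X))) (fun A f => IsPrefix f A)
    exact_mod_cast this
  have hpos : 0 < packingPotential δ fun _ : Fin k => F := by
    have h1 : ∑ f : Numbering X, ((F.filter fun A => IsPrefix f A).card : ℝ) ≤
        ∑ f : Numbering X, ((packingNumber f fun _ : Fin k => F : ℕ) : ℝ)
          + (Fintype.card X).factorial * ((k : ℝ) - 1) := by
      have : ((Fintype.card X).factorial : ℝ) * ((k : ℝ) - 1)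
          = ∑ f : Numbering X, ((k : ℝ) - 1) := by
        rw [Finset.sum_const, Finset.card_univ, Fintype.card_numbering, nsmul_eq_mul]
      rw [this, ← Finset.sum_add_distrib]
      refine Finset.sum_le_sum fun f _ => ?_
      rw [← Nat.cast_one, ← Nat.cast_sub hk]
      exact_mod_cast card_filter_isPrefix_le_packingNumber_add f F hk
    unfold packingPotential
    rw [Finset.sum_const, Finset.card_univ, Fintype.card_fin, nsmul_eq_mul]
    rw [← hcount] at h1
    linarith
  have hGpos := hpos.trans_le (hmax (fun _ => F) fun _ => subset_rfl)
  obtain ⟨f, hf⟩ : ∃ f : Numbering X, 0 < packingNumber f G := by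
    by_contra! h
    unfold packingPotential at hGpos
    rw [Finset.sum_eq_zero fun f _ => by simpa using h f] at hGpos
    have : 0 ≤ δ * ∑ i, ∑ A ∈ G i, ((prefixed A).card : ℝ) :=
      mul_nonneg hδ0 (Finset.sum_nonneg fun i _ => Finset.sum_nonneg fun A _ => Nat.cast_nonneg _)
    linarith
  exact nonempty_of_packingNumber_pos hf

end Numbering

/-! ### Concentration around the middle level. -/

/-- A Chernoff bound for the number of subsets whose size is far from the middle. -/
theorem card_filter_card_far_from_middle_mul_exp_le {X : Type*} [Fintype X] [DecidableEq X]
    {t : ℝ} (ht : 0 ≤ t) {a : ℝ} :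
    ((Finset.univ.filter fun A : Finset X =>
        a ≤ |2 * (A.card : ℝ) - Fintype.card X|).card : ℝ) * Real.exp (t * a)
      ≤ 2 * (2 ^ Fintype.card X * Real.exp (Fintype.card X * (t ^ 2 / 2))) := by
  set n := Fintype.card X with hn
  have hterm : ∀ (A : Finset X) (u : ℝ), Real.exp u ^ A.card * Real.exp (-u) ^ (n - A.card)
      = Real.exp (u * (2 * (A.card : ℝ) - n)) := by
    intro A u
    rw [← Real.exp_nat_mul, ← Real.exp_nat_mul, ← Real.exp_add, Nat.cast_sub A.card_le_univ]
    congr 1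
    ring
  have hsum : ∀ u : ℝ, ∑ A : Finset X, Real.exp (u * (2 * (A.card : ℝ) - n))
      ≤ 2 ^ n * Real.exp (n * (u ^ 2 / 2)) := by
    intro u
    -- The exponential moment factorizes as `(2 * cosh u) ^ n`.
    have h1 := Fintype.sum_pow_mul_eq_add_pow X (Real.exp u) (Real.exp (-u))
    rw [← hn] at h1
    simp only [hterm] at h1
    have h2 : Real.exp u + Real.exp (-u) = 2 * Real.cosh u := by
      rw [Real.cosh_eq]; ring
    rw [h1, h2, mul_pow, Real.exp_nat_mul]
    gcongr
    exact Real.cosh_le_exp_half_sq u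
  have hpoint : ∀ A ∈ Finset.univ.filter fun A : Finset X => a ≤ |2 * (A.card : ℝ) - n|,
      Real.exp (t * a) ≤ Real.exp (t * (2 * (A.card : ℝ) - n))
        + Real.exp (-t * (2 * (A.card : ℝ) - n)) := by
    intro A hA
    have hA := (Finset.mem_filter.1 hA).2
    rcases le_abs.1 hA with h | h
    · have := Real.exp_le_exp.2 (mul_le_mul_of_nonneg_left h ht)
      have := Real.exp_pos (-t * (2 * (A.card : ℝ) - n))
      linarith
    · have h' := Real.exp_le_exp.2 (mul_le_mul_of_nonneg_left h ht)
      have := Real.exp_pos (t * (2 * (A.card : ℝ) - n))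
      rw [mul_neg, ← neg_mul] at h'
      linarith
  calc _ = ∑ A ∈ Finset.univ.filter fun A : Finset X => a ≤ |2 * (A.card : ℝ) - n|,
        Real.exp (t * a) := by rw [Finset.sum_const, nsmul_eq_mul]
    _ ≤ ∑ A ∈ Finset.univ.filter fun A : Finset X => a ≤ |2 * (A.card : ℝ) - n|,
        (Real.exp (t * (2 * (A.card : ℝ) - n)) + Real.exp (-t * (2 * (A.card : ℝ) - n))) :=
        Finset.sum_le_sum hpoint
    _ ≤ ∑ A : Finset X,
        (Real.exp (t * (2 * (A.card : ℝ) - n)) + Real.exp (-t * (2 * (A.card : ℝ) - n))) :=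
        Finset.sum_le_sum_of_subset_of_nonneg (Finset.filter_subset _ _)
          fun _ _ _ => by positivity
    _ ≤ _ := by
        rw [Finset.sum_add_distrib]
        have h1 := hsum t
        have h2 := hsum (-t)
        rw [neg_sq] at h2
        linarith

theorem two_pow_le_succ_mul_choose_middle (n : ℕ) : 2 ^ n ≤ (n + 1) * n.choose (n / 2) := by
  rw [← Nat.sum_range_choose, ← smul_eq_mul, ← Finset.card_range (n + 1), ← Finset.sum_const,
    Finset.card_range]
  exact Finset.sum_le_sum fun i _ => Nat.choose_le_middle i n

/-- The Chernoff bound at `t = 2 * η` gives `2 * 2 ^ n * exp (-2 * η ^ 2 * n)`. Passing from `2 ^ n`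
to the middle binomial coefficient costs only a factor `n + 1`. -/
theorem eventually_card_filter_card_far_from_middle_le {η ε : ℝ} (hη : 0 < η) (hε : 0 < ε) :
    ∀ᶠ n : ℕ in atTop, ((Finset.univ.filter fun A : Finset (Fin n) =>
      2 * η * n ≤ |2 * (A.card : ℝ) - n|).card : ℝ) ≤ ε * n.choose (n / 2) := by
  have hc : 0 < 2 * η ^ 2 := by positivity
  have hlim : Tendsto (fun n : ℕ => 2 * ((n : ℝ) + 1) * Real.exp (-(2 * η ^ 2 * n)))
      atTop (nhds 0) := by
    have hx : Tendsto (fun n : ℕ => 2 * η ^ 2 * (n : ℝ)) atTop atTop :=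
      tendsto_natCast_atTop_atTop.const_mul_atTop hc
    have h1 := (Real.tendsto_pow_mul_exp_neg_atTop_nhds_zero 1).comp hx
    have h0 := (Real.tendsto_pow_mul_exp_neg_atTop_nhds_zero 0).comp hx
    have := (h1.const_mul (2 / (2 * η ^ 2))).add (h0.const_mul 2)
    simp only [mul_zero, add_zero] at this
    refine this.congr fun n => ?_
    simp only [Function.comp_apply, pow_one, pow_zero]
    field_simp
  filter_upwards [hlim.eventually (gt_mem_nhds hε)] with n hn
  have h1 := card_filter_card_far_from_middle_mul_exp_le (X := Fin n) (t := 2 * η)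
    (by positivity) (a := 2 * η * n)
  rw [Fintype.card_fin] at h1
  have h2 : (2 : ℝ) ^ n ≤ (n + 1) * n.choose (n / 2) := by
    exact_mod_cast two_pow_le_succ_mul_choose_middle n
  have hexp : Real.exp (n * ((2 * η) ^ 2 / 2))
      = Real.exp (-(2 * η ^ 2 * n)) * Real.exp (2 * η * (2 * η * n)) := by
    rw [← Real.exp_add]
    congr 1
    ring
  rw [hexp, ← mul_assoc (2 ^ n), ← mul_assoc 2 (2 ^ n * _), ← mul_assoc 2 (2 ^ n)] at h1
  refine (le_of_mul_le_mul_right h1 (Real.exp_pos _)).trans ?_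
  calc 2 * 2 ^ n * Real.exp (-(2 * η ^ 2 * n))
      ≤ 2 * ((n + 1) * n.choose (n / 2)) * Real.exp (-(2 * η ^ 2 * n)) := by gcongr
    _ = 2 * ((n : ℝ) + 1) * Real.exp (-(2 * η ^ 2 * n)) * n.choose (n / 2) := by ring
    _ ≤ ε * n.choose (n / 2) := by gcongr

/-- The LYM weight: a random maximal chain passes through `A` with probability `1 / n.choose
A.card`. -/
theorem factorial_le_card_prefixed_mul_choose_middle {n : ℕ} (A : Finset (Fin n)) :
    n.factorial ≤ (Numbering.prefixed A).card * n.choose (n / 2) := by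
  have hA : A.card ≤ n := by simpa using A.card_le_univ
  rw [Numbering.card_prefixed, Fintype.card_fin, ← Nat.choose_mul_factorial_mul_factorial hA,
    mul_assoc, mul_comm]
  exact Nat.mul_le_mul_left _ (Nat.choose_le_middle _ _)

/-! ### Upper bound: choice of constants. -/

theorem eventually_containsInduced {H : Type*} [PartialOrder H] [Finite H] (k : ℕ) (hk : 2 ≤ k)
    (hH : (SimpleGraph.hasse H).IsTree) (hheight : posetHeight H = (k : ℕ∞)) {ε : ℝ}
    (hε : 0 < ε) :
    ∀ᶠ n : ℕ in atTop, ∀ F : Finset (Finset (Fin n)),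
      ((k : ℝ) - 1 + ε) * (n.choose (n / 2) : ℝ) ≤ (F.card : ℝ) → ContainsInduced F H := by
  classical
  obtain ⟨l, hl⟩ := exists_strictMono_fin hheight
  set m := Nat.card H with hm
  have hk' : (2 : ℝ) ≤ k := by exact_mod_cast hk
  -- `δ` is small enough that the penalty, at most `k` incidences per member of the family, does not
  -- use up the surplus `ε / 2` left after trimming to the middle levels.
  obtain ⟨δ, hδ0, hδ1, hδ⟩ : ∃ δ : ℝ, 0 < δ ∧ δ ≤ 1 ∧
      (k : ℝ) - 1 < (1 - δ * k) * (k - 1 + ε / 2) ∧ δ * k < 1 := by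
    have hkε : 0 < (k : ℝ) + ε := by positivity
    have hδk : ε / (4 * k * (k + ε)) * k = ε / (4 * (k + ε)) := by
      field_simp
    refine ⟨ε / (4 * k * (k + ε)), by positivity, ?_, ?_, ?_⟩
    · rw [div_le_one (by positivity)]
      nlinarith
    · rw [hδk]
      have : ε / (4 * (k + ε)) * (k - 1 + ε / 2) < ε / 2 := by
        rw [div_mul_eq_mul_div, div_lt_div_iff₀ (by positivity) (by norm_num)]
        nlinarith
      linarith
    · rw [hδk, div_lt_one (by positivity)]
      linarith
  obtain ⟨hδ2, hδ3⟩ := hδ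
  -- With sizes within `η * n` of `n / 2`, this gives `m * 2 * (hi - lo) ≤ δ * n / 8`, while `lo ≥
  -- 15 * n / 32`.
  set η : ℝ := δ / (32 * (m + 1)) with hη
  have hη0 : 0 < η := by positivity
  have hηm : 32 * (m + 1) * η = δ := by rw [hη]; field_simp
  filter_upwards [eventually_card_filter_card_far_from_middle_le hη0 (half_pos hε),
    eventually_gt_atTop 0] with n hn hn0 F hF
  have hn0' : (0 : ℝ) < n := by exact_mod_cast hn0
  set lo := ⌈(1 / 2 - η) * (n : ℝ)⌉₊ with hlo
  have hη1 : η ≤ 1 / 32 := by nlinarith [Nat.cast_nonneg (α := ℝ) m]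
  have hlo1 : (1 / 2 - η) * (n : ℝ) ≤ lo := Nat.le_ceil _
  set F' := F.filter fun A => lo ≤ A.card ∧ A.card ≤ n - lo with hF'
  have hlon : lo ≤ n := Nat.ceil_le.2 (by nlinarith)
  have hcard : ((k : ℝ) - 1 + ε / 2) * (n.choose (n / 2) : ℝ) ≤ F'.card := by
    have hsub : F ⊆ F' ∪ Finset.univ.filter fun A : Finset (Fin n) =>
        2 * η * n ≤ |2 * (A.card : ℝ) - n| := by
      intro A hA
      by_cases h : lo ≤ A.card ∧ A.card ≤ n - lo
      · exact Finset.mem_union_left _ (Finset.mem_filter.2 ⟨hA, h⟩)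
      refine Finset.mem_union_right _ (Finset.mem_filter.2 ⟨Finset.mem_univ _, ?_⟩)
      have hAn : A.card ≤ n := by simpa using A.card_le_univ
      rcases not_and_or.1 h with h | h
      · have := Nat.lt_ceil.1 (not_le.1 h)
        exact le_abs.2 (Or.inr (by linarith))
      · have := Nat.lt_ceil.1 (show n - A.card < lo by omega)
        rw [Nat.cast_sub hAn] at this
        exact le_abs.2 (Or.inl (by linarith))
    have h1 : (F.card : ℝ) ≤ F'.card + ((Finset.univ.filter fun A : Finset (Fin n) =>
        2 * η * n ≤ |2 * (A.card : ℝ) - n|).card : ℝ) := by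
      exact_mod_cast (Finset.card_le_card hsub).trans (Finset.card_union_le _ _)
    linarith
  have hC : (0 : ℝ) < n.choose (n / 2) := by
    exact_mod_cast Nat.choose_pos (Nat.div_le_self n 2)
  have hsum : ((k : ℝ) - 1 + ε / 2) * n.factorial
      ≤ ∑ A ∈ F', ((Numbering.prefixed A).card : ℝ) := by
    have h1 : (F'.card : ℝ) * n.factorial
        ≤ (∑ A ∈ F', ((Numbering.prefixed A).card : ℝ)) * n.choose (n / 2) := by
      rw [Finset.sum_mul, ← nsmul_eq_mul, ← Finset.sum_const]
      exact Finset.sum_le_sum fun A _ => by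
        exact_mod_cast factorial_le_card_prefixed_mul_choose_middle A
    have h2 := mul_le_mul_of_nonneg_right hcard (Nat.cast_nonneg (α := ℝ) n.factorial)
    refine le_of_mul_le_mul_right ?_ hC
    linarith
  obtain ⟨G, hG, hGF, hne⟩ := Numbering.exists_extendable (k := k) (m := m) (lo := lo)
    (hi := n - lo) hδ0.le (F := F') (by omega)
    (fun A hA => (Finset.mem_filter.1 hA).2.1) (fun A hA => (Finset.mem_filter.1 hA).2.2)
    (by rw [Fintype.card_fin]; omega)
    (by
      have h1 : ((2 * (n - lo - lo) : ℕ) : ℝ) ≤ 4 * η * n := by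
        -- Rounding up may carry `lo` past `n / 2`; the natural subtraction is then zero.
        rcases le_total (2 * lo) n with h | h
        · have : ((2 * (n - lo - lo) : ℕ) : ℝ) = 2 * (n - 2 * lo) := by
            rw [show n - lo - lo = n - 2 * lo by omega]
            push_cast [Nat.cast_sub h]
            ring
          rw [this]
          linarith
        · rw [show 2 * (n - lo - lo) = 0 by omega, Nat.cast_zero]
          positivity
      calc (m : ℝ) * ((2 * (n - lo - lo) : ℕ) : ℝ) ≤ (m + 1) * (4 * η * n) := by
            gcongr; linarith
        _ = δ * (n / 8) := by rw [← hηm]; ring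
        _ < δ * lo := by
            gcongr
            nlinarith)
    (by
      rw [Fintype.card_fin]
      have hfac : (0 : ℝ) < n.factorial := by exact_mod_cast n.factorial_pos
      calc ((k : ℝ) - 1) * n.factorial
          < (1 - δ * k) * (k - 1 + ε / 2) * n.factorial := by gcongr
        _ = (1 - δ * k) * ((k - 1 + ε / 2) * n.factorial) := by ring
        _ ≤ _ := mul_le_mul_of_nonneg_left hsum (by linarith))
  obtain ⟨g, hg, hgle⟩ := hG.exists_orderEmbedding hGF hne m H hm.symm le_rfl hH l hl
  refine ⟨g, fun x y h => le_antisymm ((hgle x y).2 h.subset) ((hgle y x).2 h.symm.subset),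
    fun x => Finset.filter_subset _ _ (hGF _ (hg x)), hgle⟩

/-! ### Lower bound and conclusion. -/

/-- Consecutive binomial coefficients have ratio `(n - q) / (q + 1)`, which tends to 1 at bounded
distance from the middle. The induction spends `c / 2` twice, as `(1 - c / 2) ^ 2 ≥ 1 - c`. -/
theorem eventually_mul_choose_middle_le_choose_middle_add (j : ℕ) :
    ∀ c : ℝ, 0 < c → ∀ᶠ n : ℕ in atTop,
      (1 - c) * (n.choose (n / 2) : ℝ) ≤ n.choose (n / 2 + j) := by
  induction j with
  | zero =>
    intro c hc
    filter_upwards with n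
    rw [add_zero]
    nlinarith [Nat.cast_nonneg (α := ℝ) (n.choose (n / 2))]
  | succ j ih =>
    intro c hc
    rcases le_or_gt 1 c with hc1 | hc1
    · filter_upwards with n
      exact (mul_nonpos_of_nonpos_of_nonneg (by linarith) (Nat.cast_nonneg _)).trans
        (Nat.cast_nonneg _)
    have hlarge : ∀ᶠ n : ℕ in atTop, (2 * j + 1 : ℝ) / (c / 4) ≤ n :=
      tendsto_natCast_atTop_atTop.eventually_ge_atTop _
    filter_upwards [ih (c / 2) (by linarith), hlarge, eventually_ge_atTop (2 * j)]
      with n hn hnl hnj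
    rw [div_le_iff₀ (by linarith)] at hnl
    set q := n / 2 + j with hq
    have hqn : q ≤ n := by omega
    have hrec : (n.choose (q + 1) : ℝ) * (q + 1) = n.choose q * ((n : ℝ) - q) := by
      rw [← Nat.cast_sub hqn]
      exact_mod_cast Nat.choose_succ_right_eq n q
    have h1 : 2 * (q : ℝ) ≤ n + 2 * j := by
      have : 2 * q ≤ n + 2 * j := by omega
      exact_mod_cast this
    have h2 : (n : ℝ) ≤ 2 * (q + 1) := by
      have : n ≤ 2 * (q + 1) := by omega
      exact_mod_cast this
    have h3 : (1 - c / 2) * ((q : ℝ) + 1) ≤ n - q := by nlinarith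
    have hq0 : (0 : ℝ) < q + 1 := by positivity
    have h4 : (1 - c / 2) * (n.choose q : ℝ) ≤ n.choose (q + 1) := by
      refine le_of_mul_le_mul_right ?_ hq0
      rw [hrec]
      nlinarith [mul_le_mul_of_nonneg_left h3 (Nat.cast_nonneg (α := ℝ) (n.choose q))]
    have h5 := mul_le_mul_of_nonneg_left hn (by linarith : (0 : ℝ) ≤ 1 - c / 2)
    rw [← add_assoc, ← hq]
    nlinarith [Nat.cast_nonneg (α := ℝ) (n.choose (n / 2)), sq_nonneg c]

/-- A chain of `k` elements would map to sets of `k` distinct sizes, and only `k - 1` sizes are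
available. -/
theorem not_containsInduced_of_card_mem_Ico {H : Type*} [PartialOrder H] [Finite H] {k n a : ℕ}
    (hk : 1 ≤ k) (hheight : posetHeight H = (k : ℕ∞)) {F : Finset (Finset (Fin n))}
    (hF : ∀ A ∈ F, A.card ∈ Finset.Ico a (a + (k - 1))) : ¬ ContainsInduced F H := by
  rintro ⟨f, hinj, hfF, hle⟩
  obtain ⟨t, -, htcard, hchain⟩ := Set.exists_eq_chainHeight_of_finite (Set.univ : Set H) (· ≤ ·)
    Set.finite_univ
  change _ = posetHeight H at htcard
  rw [hheight] at htcard
  have hinjOn : Set.InjOn (fun x => (f x).card) t := by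
    intro x hx y hy hxy
    rcases hchain.total hx hy with h | h
    · exact hinj (Finset.eq_of_subset_of_card_le ((hle _ _).1 h) hxy.ge)
    · exact (hinj (Finset.eq_of_subset_of_card_le ((hle _ _).1 h) hxy.le)).symm
  have h1 := Set.encard_le_encard (show (fun x => (f x).card) '' t ⊆
    (Finset.Ico a (a + (k - 1)) : Set ℕ) by
      rintro _ ⟨x, -, rfl⟩
      exact hF _ (hfF x))
  rw [hinjOn.encard_image, htcard, Set.encard_coe_eq_coe_finsetCard, Nat.card_Ico] at h1
  norm_cast at h1
  omega

theorem sum_choose_le_LaStar {H : Type*} [PartialOrder H] [Finite H] {k : ℕ} (hk : 1 ≤ k)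
    (hheight : posetHeight H = (k : ℕ∞)) (n a : ℕ) :
    ∑ j ∈ Finset.range (k - 1), n.choose (a + j) ≤ LaStar n H := by
  classical
  let F : Finset (Finset (Fin n)) :=
    (Finset.range (k - 1)).biUnion fun j => Finset.powersetCard (a + j) Finset.univ
  have hF : ¬ ContainsInduced F H := by
    refine not_containsInduced_of_card_mem_Ico (a := a) hk hheight fun A hA => ?_
    obtain ⟨j, hj, hA⟩ := Finset.mem_biUnion.1 hA
    rw [Finset.mem_range] at hj
    rw [(Finset.mem_powersetCard.1 hA).2, Finset.mem_Ico]
    omega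
  have hcard : F.card = ∑ j ∈ Finset.range (k - 1), n.choose (a + j) := by
    rw [Finset.card_biUnion]
    · simp
    · intro i _ j _ hij
      exact Finset.pairwise_disjoint_powersetCard _ (by omega)
  rw [← hcard]
  unfold LaStar
  exact Finset.le_sup (f := Finset.card) (by simpa using hF)

theorem LaStar_le_of_forall_containsInduced {H : Type*} [PartialOrder H] {n : ℕ} {b : ℝ}
    (hb : 0 ≤ b)
    (h : ∀ F : Finset (Finset (Fin n)), b ≤ F.card → ContainsInduced F H) :
    (LaStar n H : ℝ) ≤ b := by
  classical
  have : LaStar n H ≤ ⌊b⌋₊ := by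
    refine Finset.sup_le fun F hF => Nat.le_floor ?_
    by_contra! hlt
    exact (Finset.mem_filter.1 hF).2 (h F hlt.le)
  exact (Nat.le_floor_iff hb).1 this

theorem theorem1p2 {H : Type*} [PartialOrder H] [Finite H] (k : ℕ) (hk : 2 ≤ k)
    (hH : (SimpleGraph.hasse H).IsTree) (hheight : posetHeight H = (k : ℕ∞)) :
    ((fun n : ℕ => (LaStar n H : ℝ)) ~[atTop]
        fun n : ℕ => ((k : ℝ) - 1) * (n.choose (n / 2) : ℝ)) ∧
      ∀ ε : ℝ, 0 < ε → ∀ᶠ n : ℕ in atTop, ∀ F : Finset (Finset (Fin n)),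
        ((k : ℝ) - 1 + ε) * (n.choose (n / 2) : ℝ) ≤ (F.card : ℝ) → ContainsInduced F H := by
  have hupper : ∀ ε : ℝ, 0 < ε → ∀ᶠ n : ℕ in atTop, ∀ F : Finset (Finset (Fin n)),
      ((k : ℝ) - 1 + ε) * (n.choose (n / 2) : ℝ) ≤ (F.card : ℝ) → ContainsInduced F H :=
    fun ε hε => eventually_containsInduced k hk hH hheight hε
  refine ⟨?_, hupper⟩
  have hk' : (0 : ℝ) < (k : ℝ) - 1 := by
    have : (2 : ℝ) ≤ k := by exact_mod_cast hk
    linarith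
  refine Asymptotics.isLittleO_iff.2 fun c hc => ?_
  have hlower : ∀ᶠ n : ℕ in atTop, ∀ j ∈ Finset.range (k - 1),
      (1 - c) * (n.choose (n / 2) : ℝ) ≤ n.choose (n / 2 + j) :=
    (Finset.eventually_all _).2 fun j _ =>
      eventually_mul_choose_middle_le_choose_middle_add j c hc
  -- With `ε = c * (k - 1)` the threshold becomes `(1 + c) * (k - 1)` times the middle binomial
  -- coefficient.
  filter_upwards [hupper (c * (k - 1)) (by positivity), hlower] with n hn hnl
  have hb : 0 ≤ ((k : ℝ) - 1) * (n.choose (n / 2) : ℝ) := by positivity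
  have h1 := LaStar_le_of_forall_containsInduced (by positivity) hn
  have h2 : ((k : ℝ) - 1) * ((1 - c) * (n.choose (n / 2) : ℝ)) ≤ LaStar n H := by
    have h3 : ((∑ j ∈ Finset.range (k - 1), n.choose (n / 2 + j) : ℕ) : ℝ) ≤ LaStar n H := by
      exact_mod_cast sum_choose_le_LaStar (by omega) hheight n (n / 2)
    have h4 := Finset.sum_le_sum hnl
    rw [Finset.sum_const, Finset.card_range, nsmul_eq_mul, Nat.cast_sub (by omega),
      Nat.cast_one] at h4
    push_cast at h3
    exact h4.trans h3
  rw [Pi.sub_apply, Real.norm_eq_abs, Real.norm_eq_abs, abs_of_nonneg hb, abs_le]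
  constructor <;> nlinarith
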